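/- Let $\mathbb{K}$ be a field and let $m$ be a positive integer. **Definitions.** For a finite totally ordered index set $I$, a shift $s\in\mathbb{Z}^I$ and a row vector $p\in\mathbb{K}[X]^{I}$, the $s$-degree of $p$ is $\max_j(\deg p_j+s_j)$ (with $\deg 0=-\infty$). If $p\ne 0$, its $s$-pivot index is the largest $j$ attaining this maximum, and $p_j$ and $\deg p_j$ are then its $s$-pivot entry and $s$-pivot degree. For a matrix $P$, $\mathrm{rdeg}_s(P)$ is the tuple of $s$-degrees of its rows. A matrix of full row rank is in $s$-Popov form if the $s$-pivot indices of its rows are strictly increasing, its pivot entries are monic, and in each column containing a pivot the nonpivot entries have degree less than the pivot entry; its $s$-pivot degree is then the tuple of the $s$-pivot degrees of its rows. For a nonzero modulus $\mathfrak{a}\in\mathbb{K}[X]$ and a column $H\in\mathbb{K}[X]^{I\times 1}$, the $s$-Popov solution basis for $(\mathfrak{a},H)$ is the unique square matrix in $s$-Popov form whose rows form a basis of the $\mathbb{K}[X]$-module $\{p\in\mathbb{K}[X]^{1\times I} : pH=0 \bmod \mathfrak{a}\}$; its $s$-pivot degree is called the $s$-minimal degree of $(\mathfrak{a},H)$. The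 $s$-Popov order basis for $H$ and $\tau\in\mathbb{N}$ is the $s$-Popov solution basis for $(X^\tau,H)$. For a tuple of nonnegative integers or of integers, $|\cdot|$ denotes the sum of its entries. Given $\delta\in\mathbb{N}^I$ and $t\in\mathbb{Z}^I$ with $I=\{\mu_1,\dots,\mu_n\}$, $t_{\mu_1}\le\dots\le t_{\mu_n}$, an integer $i\in\{1,\dots,n-1\}$ is a splitting index for $(\delta,t)$ if $\delta_{\mu_k}+t_{\mu_k}-t_{\mu_{i+1}}<0$ for all $1\le k\le i$. **Setting.** Let $\mathfrak{m}\in\mathbb{K}[X]$ be nonzero of degree $\sigma$, let $F\in\mathbb{K}[X]^{m\times1}$ have all its entries of degree $<\deg\mathfrak{m}$, let $s\in\mathbb{Z}^m$, and let $\delta\in\mathbb{N}^m$ be the $s$-minimal degree of $(\mathfrak{m},F)$. Fix a permutation $\pi$ of $\{1,\dots,m\}$ with $s_{\pi_1}\le\dots\le s_{\pi_m}$. The subscript $[:k]$ (resp. $[k+1:]$) denotes restriction of a tuple, or of the rows or columns of a matrix, to the indices in $\{\pi_1,\dots,\pi_k\}$ (resp. $\{\pi_{k+1},\dots,\pi_m\}$),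 sorted increasingly; for a matrix, the first subscript refers to rows, the second one to columns, and $*$ to all columns. Let $2\le j\le m$, let $\delta^{(0)}$ be the $s_{[:j]}$-minimal degree of $(\mathfrak{m},F_{[:j]})$, and let $i$ be a splitting index for $(\delta^{(0)},s_{[:j]})$. Let $\delta^{(1)}$ be the $s_{[:i]}$-minimal degree of $(\mathfrak{m},F_{[:i]})$. Put $s^{(2)}=s_{[i+1:]}$ and $d=-\delta^{(1)}+\min(s^{(2)})-2\sigma\in\mathbb{Z}^i$ (constants being added to every entry), let $v\in\mathbb{Z}^m$ be such that $v_{[:i]}=d$ and $v_{[i+1:]}=s^{(2)}$, and let $u=(v,\min(d))\in\mathbb{Z}^{m+1}$. Let $$\begin{bmatrix}A & \mathbf{q}\\ \mathbf{p} & q\end{bmatrix},\qquad A\in\mathbb{K}[X]^{m\times m},\ \mathbf{q}\in\mathbb{K}[X]^{m\times1},\ \mathbf{p}\in\mathbb{K}[X]^{1\times m},\ q\in\mathbb{K}[X],$$ be the $u$-Popov order basis for the column $\begin{bmatrix}F\\ \mathfrak{m}\end{bmatrix}$ and the order $2\sigma$. Let $P^{(2)}=A_{[i+1:],[i+1:]}$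 (which is in $s^{(2)}$-Popov form) and let $\delta^{(2)}$ be its $s^{(2)}$-pivot degree. **Statement.** Define $$\mathfrak{n}=X^{-2\sigma}\,(\mathbf{p}F+q\,\mathfrak{m}),\qquad G=X^{-2\sigma}\,(A_{[i+1:],*}F+\mathbf{q}_{[i+1:]}\,\mathfrak{m}).$$ Then $\mathfrak{n}\in\mathbb{K}[X]$, $G\in\mathbb{K}[X]^{(m-i)\times1}$, and $$\deg G<\deg\mathfrak{n}\le\sigma-|\delta^{(1)}|-|\delta^{(2)}| .$$ Moreover, let $P^{(3)}$ be the $t$-Popov solution basis for $(\mathfrak{n},G)$, where $t=\mathrm{rdeg}_{s^{(2)}}(P^{(2)})$, and let $\delta^{(3)}$ be its $t$-pivot degree. Then $$(\delta_{[:i]},\delta_{[i+1:]})=(\delta^{(1)},\ \delta^{(2)}+\delta^{(3)}).$$ -/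

import Mathlib

open Polynomial

noncomputable section

/-- Degree of a polynomial as an element of `{-∞} ∪ ℤ` (the zero polynomial has degree `-∞ = ⊥`). -/
def zdeg {K : Type*} [Field K] (p : K[X]) : WithBot ℤ :=
  p.degree.map (fun n : ℕ => (n : ℤ))

/-- The `s`-degree `max_j (deg p_j + s_j)` of a row vector `p`, in `{-∞} ∪ ℤ`. -/
def shiftedDegree {K : Type*} [Field K] {ι : Type*} [Fintype ι] (s : ι → ℤ) (p : ι → K[X]) :
    WithBot ℤ :=
  Finset.univ.sup fun j => zdeg (p j) + (s j : WithBot ℤ)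

/-- The `s`-row degree of a matrix without zero row, as a tuple of integers
(the entry at a zero row, whose `s`-degree is `-∞`, is set to `0` and is never used). -/
def rowDegree {K : Type*} [Field K] {ρ ι : Type*} [Fintype ι] (s : ι → ℤ)
    (P : Matrix ρ ι K[X]) : ρ → ℤ :=
  fun i => (shiftedDegree s (P i)).unbotD 0

/-- `j` is the `s`-pivot index of the row vector `p`: `p` is nonzero and `j` is the largest index
at which the `s`-degree of `p` is attained. -/
def IsPivotIndex {K : Type*} [Field K] {ι : Type*} [Fintype ι] [LinearOrder ι]
    (s : ι → ℤ) (p : ι → K[X]) (j : ι) : Prop :=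
  p ≠ 0 ∧ IsGreatest {k : ι | shiftedDegree s p = zdeg (p k) + (s k : WithBot ℤ)} j

/-- A polynomial matrix (of full row rank) is in `s`-Popov form: the `s`-pivot indices of its rows
are strictly increasing, the pivot entries are monic, and in each column which contains a pivot
the nonpivot entries have degree less than the pivot entry. -/
def IsPopov {K : Type*} [Field K] {ρ ι : Type*} [LinearOrder ρ] [Fintype ι] [LinearOrder ι]
    (s : ι → ℤ) (P : Matrix ρ ι K[X]) : Prop :=
  LinearIndependent K[X] P.row ∧
  ∃ piv : ρ → ι, StrictMono piv ∧
    (∀ i, IsPivotIndex s (P i) (piv i)) ∧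
    (∀ i, (P i (piv i)).Monic) ∧
    (∀ i k, k ≠ i → (P k (piv i)).degree < (P i (piv i)).degree)

/-- `δ` is the `s`-pivot degree of `P`: `δ i` is the degree of the `s`-pivot entry of row `i`. -/
def HasPivotDegree {K : Type*} [Field K] {ρ ι : Type*} [Fintype ι] [LinearOrder ι]
    (s : ι → ℤ) (P : Matrix ρ ι K[X]) (δ : ρ → ℕ) : Prop :=
  ∀ i, ∃ j, IsPivotIndex s (P i) j ∧ (P i j).degree = (δ i : WithBot ℕ)

/-- The module of solutions for `(a, F)`, in the case of one equation: all row vectors `p` such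
that `p F = 0 mod a`, where `F` is a column of polynomials. -/
def solutionModule {K : Type*} [Field K] {ι : Type*} [Fintype ι] (a : K[X]) (F : ι → K[X]) :
    Submodule K[X] (ι → K[X]) where
  carrier := {p | a ∣ p ⬝ᵥ F}
  zero_mem' := by simp
  add_mem' := by
    intro p q hp hq
    simp only [Set.mem_ofPred_eq, add_dotProduct] at *
    exact dvd_add hp hq
  smul_mem' := by
    intro c p hp
    simp only [Set.mem_ofPred_eq, smul_dotProduct, smul_eq_mul] at *
    exact Dvd.dvd.mul_left hp c

/-- `P` is a solution basis for `(a, F)`: its rows form a basis of the solution module. -/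
def IsSolutionBasis {K : Type*} [Field K] {ι : Type*} [Fintype ι] (a : K[X]) (F : ι → K[X])
    (P : Matrix ι ι K[X]) : Prop :=
  LinearIndependent K[X] P.row ∧ Submodule.span K[X] (Set.range P.row) = solutionModule a F

/-- `P` is the `s`-Popov solution basis for `(a, F)`. -/
def IsPopovSolutionBasis {K : Type*} [Field K] {ι : Type*} [Fintype ι] [LinearOrder ι]
    (s : ι → ℤ) (a : K[X]) (F : ι → K[X]) (P : Matrix ι ι K[X]) : Prop :=
  IsSolutionBasis a F P ∧ IsPopov s P

/-- `P` is the `s`-Popov order basis for the column `N` and the order `τ`: the `s`-Popov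
solution basis for `(X ^ τ, N)`. -/
def IsPopovOrderBasis {K : Type*} [Field K] {ι : Type*} [Fintype ι] [LinearOrder ι]
    (s : ι → ℤ) (N : ι → K[X]) (τ : ℕ) (P : Matrix ι ι K[X]) : Prop :=
  IsPopovSolutionBasis s (X ^ τ) N P

/-- `δ` is the `s`-minimal degree of `(a, F)`: the `s`-pivot degree of the `s`-Popov solution
basis for `(a, F)`. -/
def IsMinimalDegree {K : Type*} [Field K] {ι : Type*} [Fintype ι] [LinearOrder ι]
    (s : ι → ℤ) (a : K[X]) (F : ι → K[X]) (δ : ι → ℕ) : Prop :=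
  ∃ P : Matrix ι ι K[X], IsPopovSolutionBasis s a F P ∧ HasPivotDegree s P δ

/-- The first `i` indices `{π_1, …, π_i}` in the ordering given by `π` (positions are counted from
`0` in `Fin m`), with the order inherited from `Fin m`, so that subtuples and submatrices are
indexed by this set sorted increasingly. -/
abbrev Head {m : ℕ} (π : Equiv.Perm (Fin m)) (i : ℕ) : Type :=
  {k : Fin m // ((π.symm k : Fin m) : ℕ) < i}

/-- The remaining indices `{π_{i+1}, …, π_m}`, with the order inherited from `Fin m`. -/
abbrev Tail {m : ℕ} (π : Equiv.Perm (Fin m)) (i : ℕ) : Type :=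
  {k : Fin m // ¬ ((π.symm k : Fin m) : ℕ) < i}

/-- `i` is a splitting index for `(d, t)`, two tuples of length `n` with entries indexed by `ι`:
for an enumeration `μ` of the indices along which `t` is non-decreasing one has
`1 ≤ i ≤ n - 1` and `d_{μ_j} + t_{μ_j} - t_{μ_{i+1}} < 0` for `1 ≤ j ≤ i`.
(Positions are counted from `0`, so that `μ_{i+1}` is `μ ⟨i, _⟩`. The inequalities force the entries
of `t` at `μ_1, …, μ_i` to be smaller than all others, so the choice of `μ` does not matter.) -/
def IsSplittingIndex {ι : Type*} (n : ℕ) (d : ι → ℕ) (t : ι → ℤ) (i : ℕ) : Prop :=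
  1 ≤ i ∧ ∃ h : i < n, ∃ μ : Fin n ≃ ι, Monotone (t ∘ μ) ∧
    ∀ j : Fin n, (j : ℕ) < i → (d (μ j) : ℤ) + t (μ j) - t (μ ⟨i, h⟩) < 0

/-- The tuple `v` of length `m` with subtuple `d` at `{π_1, …, π_i}` and subtuple `e` at
`{π_{i+1}, …, π_m}`. -/
def glue {m : ℕ} {α : Type*} (π : Equiv.Perm (Fin m)) (i : ℕ) (d : Head π i → α)
    (e : Tail π i → α) : Fin m → α :=
  fun k => if h : ((π.symm k : Fin m) : ℕ) < i then d ⟨k, h⟩ else e ⟨k, h⟩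

/-- The tuple `(v_1, …, v_m, c)`. -/
def appendEntry {m : ℕ} {α : Type*} (v : Fin m → α) (c : α) : Fin (m + 1) → α :=
  Fin.snoc (α := fun _ => α) v c

end

/-!
For the splitting index `i`, the `s`-degree of each head row of the Popov solution basis of
`(𝔪, F)` lies below all tail entries of `s`, so these rows vanish on the tail indices. Completed
by their cofactors they are syzygies of `[F; 𝔪]`, and the shift `u` is such that `B` has to find
them: the head rows of `B` have pivot degrees at most `δ_{[:i]}`, hence residuals of negative
degree, that is, residuals equal to `0`; being syzygies, they have pivot degrees exactly
`δ_{[:i]}`.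

The pivot degrees of `B` add up to at most `2σ`, because the row vectors reduced modulo `B` embed
into `K[X] / X ^ (2σ)`. The last row of `B` is dominated by its last entry, of degree `deg 𝔫 + σ`;
this bounds `deg 𝔫`, and then `deg G`.

As the head residuals are `0`, a combination `z B` of the rows of `B` is a syzygy of `[F; 𝔪]` if
and only if the tail and last entries of `z` form a syzygy of `[G; 𝔫]`. By the predictable pivot
property a `t`-pivot of `z` at a tail index `l` becomes an `s`-pivot of `z B` at `l`, with degree
increased by `δ⁽²⁾_l`. Both minimal degrees are minimal degrees of such pivots, so
`δ_{[i+1:]} = δ⁽²⁾ + δ⁽³⁾`.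
-/

section

variable {K : Type*} [Field K]

section zdeg

variable {f g : K[X]} {D E : ℤ}

theorem zdeg_zero : zdeg (0 : K[X]) = ⊥ := by
  rw [zdeg, degree_zero]
  rfl

theorem zdeg_eq_natDegree (hf : f ≠ 0) : zdeg f = ((f.natDegree : ℤ) : WithBot ℤ) := by
  rw [zdeg, degree_eq_natDegree hf]
  rfl

theorem zdeg_le_iff : zdeg f ≤ D ↔ (f ≠ 0 → (f.natDegree : ℤ) ≤ D) := by
  rcases eq_or_ne f 0 with rfl | hf
  · simp [zdeg_zero]
  · simp [zdeg_eq_natDegree hf, hf]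

variable (K) in
/-- The space of polynomials of degree at most the integer `D`, the analogue for `zdeg` of
`Polynomial.degreeLE`; the truncation `Int.toNat` makes it the zero space for negative `D`. -/
noncomputable def zdegLE (D : ℤ) : Submodule K K[X] :=
  degreeLT K (D + 1).toNat

theorem mem_zdegLE_iff_natDegree_le : f ∈ zdegLE K D ↔ (f ≠ 0 → (f.natDegree : ℤ) ≤ D) := by
  rw [zdegLE, mem_degreeLT]
  rcases eq_or_ne f 0 with rfl | hf
  · simp
  · rw [← natDegree_lt_iff_degree_lt hf]
    simp only [ne_eq, hf, not_false_eq_true, true_imp_iff]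
    omega

theorem mem_zdegLE : f ∈ zdegLE K D ↔ zdeg f ≤ D :=
  mem_zdegLE_iff_natDegree_le.trans zdeg_le_iff.symm

theorem natDegree_le_of_mem_zdegLE (h : f ∈ zdegLE K D) (hf : f ≠ 0) : (f.natDegree : ℤ) ≤ D :=
  mem_zdegLE_iff_natDegree_le.mp h hf

theorem mem_zdegLE_natDegree (f : K[X]) : f ∈ zdegLE K f.natDegree :=
  mem_zdegLE_iff_natDegree_le.mpr fun _ => le_rfl

theorem zdegLE_mono (h : D ≤ E) : zdegLE K D ≤ zdegLE K E := fun _ hf =>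
  mem_zdegLE_iff_natDegree_le.mpr fun h0 => (natDegree_le_of_mem_zdegLE hf h0).trans h

theorem eq_zero_of_mem_zdegLE_of_neg (h : f ∈ zdegLE K D) (hD : D < 0) : f = 0 := by
  by_contra hf
  have := natDegree_le_of_mem_zdegLE h hf
  omega

theorem mul_mem_zdegLE (hf : f ∈ zdegLE K D) (hg : g ∈ zdegLE K E) : f * g ∈ zdegLE K (D + E) := by
  refine mem_zdegLE_iff_natDegree_le.mpr fun h => ?_
  have hf' := natDegree_le_of_mem_zdegLE hf (left_ne_zero_of_mul h)
  have hg' := natDegree_le_of_mem_zdegLE hg (right_ne_zero_of_mul h)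
  rw [natDegree_mul (left_ne_zero_of_mul h) (right_ne_zero_of_mul h)]
  push_cast
  exact add_le_add hf' hg'

theorem mem_zdegLE_of_mul_mem (h : g * f ∈ zdegLE K D) (hg : g ≠ 0) :
    f ∈ zdegLE K (D - g.natDegree) := by
  refine mem_zdegLE_iff_natDegree_le.mpr fun hf => ?_
  have := natDegree_le_of_mem_zdegLE h (mul_ne_zero hg hf)
  rw [natDegree_mul hg hf] at this
  omega

theorem mem_zdegLE_of_degree_lt (h : f.degree < g.degree) : f ∈ zdegLE K (g.natDegree - 1) := by
  refine mem_zdegLE_iff_natDegree_le.mpr fun hf => ?_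
  have := natDegree_lt_natDegree hf h
  omega

theorem degree_lt_of_mem_zdegLE (h : f ∈ zdegLE K (g.natDegree - 1)) (hg : g ≠ 0) :
    f.degree < g.degree := by
  rwa [zdegLE, sub_add_cancel, Int.toNat_natCast, mem_degreeLT, ← degree_eq_natDegree hg] at h

end zdeg

section IsPivotIndex

/-- The tie-breaking term of the order on monomials that defines pivots: at equal `s`-degree the
entry at the larger index wins, so entries to the right of a pivot `l` have `s`-degree smaller by
at least `1`. -/
def tieBreak {ι : Type*} [LinearOrder ι] (l k : ι) : ℤ := if l < k then 1 else 0

section tieBreak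

variable {ι κ : Type*} [LinearOrder ι] [LinearOrder κ]

theorem tieBreak_self (l : ι) : tieBreak l l = 0 := by simp [tieBreak]

theorem tieBreak_nonneg (l k : ι) : 0 ≤ tieBreak l k := by grind [tieBreak]

theorem tieBreak_le_one (l k : ι) : tieBreak l k ≤ 1 := by grind [tieBreak]

theorem tieBreak_triangle (l a k : ι) : tieBreak l k ≤ tieBreak l a + tieBreak a k := by
  grind [tieBreak]

theorem tieBreak_add_swap {l k : ι} (h : l ≠ k) : tieBreak l k + tieBreak k l = 1 := by
  grind [tieBreak]

theorem tieBreak_orderEmbedding (f : κ ↪o ι) (l k : κ) : tieBreak (f l) (f k) = tieBreak l k := by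
  simp only [tieBreak, f.lt_iff_lt]

end tieBreak

variable {ι κ : Type*} [Fintype ι] [LinearOrder ι] [Fintype κ] [LinearOrder κ] {s : ι → ℤ}
  {p : ι → K[X]} {l l' : ι}

theorem shiftedDegree_le_iff {κ : Type*} [Fintype κ] {s : κ → ℤ} {p : κ → K[X]} {D : ℤ} :
    shiftedDegree s p ≤ D ↔ ∀ k, p k ∈ zdegLE K (D - s k) := by
  simp only [shiftedDegree, Finset.sup_le_iff, Finset.mem_univ, true_imp_iff]
  refine forall_congr' fun k => ?_
  rcases eq_or_ne (p k) 0 with hk | hk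
  · simp [hk, zdeg_zero]
  · rw [mem_zdegLE, zdeg_eq_natDegree hk, ← WithBot.coe_add, WithBot.coe_le_coe, WithBot.coe_le_coe,
      le_sub_iff_add_le]

namespace IsPivotIndex

theorem apply_ne_zero (h : IsPivotIndex s p l) : p l ≠ 0 := by
  obtain ⟨hp, hl, -⟩ := h
  contrapose! hp
  have hbot : shiftedDegree s p = ⊥ := by rw [hl, hp, zdeg_zero, WithBot.bot_add]
  funext k
  refine eq_zero_of_mem_zdegLE_of_neg
    (shiftedDegree_le_iff (s := s) (D := s k - 1).mp ?_ k) (by omega)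
  rw [hbot]
  exact bot_le

theorem shiftedDegree_eq (h : IsPivotIndex s p l) :
    shiftedDegree s p = (((p l).natDegree + s l : ℤ) : WithBot ℤ) := by
  rw [h.2.1, zdeg_eq_natDegree h.apply_ne_zero, WithBot.coe_add]

theorem unique (h : IsPivotIndex s p l) (h' : IsPivotIndex s p l') : l = l' :=
  h.2.unique h'.2

theorem mem_zdegLE (h : IsPivotIndex s p l) (k : ι) :
    p k ∈ zdegLE K ((p l).natDegree + s l - s k - tieBreak l k) := by
  have hle := shiftedDegree_le_iff.mp h.shiftedDegree_eq.le k
  refine mem_zdegLE_iff_natDegree_le.mpr fun hk => ?_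
  have hdeg := natDegree_le_of_mem_zdegLE hle hk
  have hne : l < k → ((p k).natDegree + s k : ℤ) ≠ (p l).natDegree + s l := by
    refine fun hlk heq => hlk.not_ge (h.2.2 ?_)
    rw [Set.mem_ofPred_eq, h.shiftedDegree_eq, zdeg_eq_natDegree hk, ← WithBot.coe_add, heq]
  grind [tieBreak]

end IsPivotIndex

theorem isPivotIndex_iff : IsPivotIndex s p l ↔
    p l ≠ 0 ∧ ∀ k, p k ∈ zdegLE K ((p l).natDegree + s l - s k - tieBreak l k) := by
  refine ⟨fun h => ⟨h.apply_ne_zero, h.mem_zdegLE⟩, fun ⟨hl, hp⟩ => ?_⟩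
  have hdeg : shiftedDegree s p = (((p l).natDegree + s l : ℤ) : WithBot ℤ) := by
    refine le_antisymm (shiftedDegree_le_iff.mpr fun k => zdegLE_mono ?_ (hp k)) ?_
    · have := tieBreak_nonneg l k
      omega
    · rw [WithBot.coe_add, ← zdeg_eq_natDegree hl]
      exact Finset.le_sup (f := fun j => zdeg (p j) + (s j : WithBot ℤ)) (Finset.mem_univ l)
  refine ⟨fun h0 => hl (congrFun h0 l), ?_, fun k hk => not_lt.mp fun hlk => ?_⟩
  · rw [Set.mem_ofPred_eq, hdeg, zdeg_eq_natDegree hl, WithBot.coe_add]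
  · rw [Set.mem_ofPred_eq, hdeg] at hk
    have hk0 : p k ≠ 0 := fun h0 => by simp [h0, zdeg_zero] at hk
    rw [zdeg_eq_natDegree hk0, ← WithBot.coe_add, WithBot.coe_inj] at hk
    have := natDegree_le_of_mem_zdegLE (hp k) hk0
    grind [tieBreak]

theorem exists_isPivotIndex (s : ι → ℤ) (hp : p ≠ 0) : ∃ l, IsPivotIndex s p l := by
  obtain ⟨k, -⟩ := Function.ne_iff.mp hp
  obtain ⟨j, -, hj⟩ := Finset.exists_mem_eq_sup Finset.univ ⟨k, Finset.mem_univ k⟩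
    fun k => zdeg (p k) + (s k : WithBot ℤ)
  obtain ⟨l, hl⟩ := (Set.toFinite
    {k | shiftedDegree s p = zdeg (p k) + (s k : WithBot ℤ)}).exists_maximal ⟨j, hj⟩
  exact ⟨l, hp, maximal_iff_isGreatest.mp hl⟩

theorem isPivotIndex_orderEmbedding_iff (f : κ ↪o ι) {l : κ} : IsPivotIndex s p (f l) ↔
    IsPivotIndex (s ∘ f) (p ∘ f) l ∧ ∀ k ∉ Set.range f,
      p k ∈ zdegLE K ((p (f l)).natDegree + s (f l) - s k - tieBreak (f l) k) := by
  simp only [isPivotIndex_iff, Function.comp_apply, ← tieBreak_orderEmbedding f]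
  refine ⟨fun h => ⟨⟨h.1, fun k => h.2 (f k)⟩, fun k _ => h.2 k⟩, fun h => ⟨h.1.1, fun k => ?_⟩⟩
  by_cases hk : k ∈ Set.range f
  · obtain ⟨k, rfl⟩ := hk
    exact h.1.2 k
  · exact h.2 k hk

/-- The predictable pivot property. -/
theorem IsPivotIndex.vecMul {P : Matrix ι ι K[X]} (hP : ∀ k, IsPivotIndex s (P k) k)
    (h : IsPivotIndex (fun k => ((P k k).natDegree : ℤ) + s k) p l) :
    IsPivotIndex s (Matrix.vecMul p P) l ∧
      (Matrix.vecMul p P l).natDegree = (p l).natDegree + (P l l).natDegree := by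
  have hterm (a k : ι) : p a * P a k ∈ zdegLE K ((p l).natDegree + (P l l).natDegree + s l - s k -
      (tieBreak l a + tieBreak a k)) :=
    zdegLE_mono (by omega) (mul_mem_zdegLE (h.mem_zdegLE a) ((hP a).mem_zdegLE k))
  have hl := h.apply_ne_zero
  have hPl := (hP l).apply_ne_zero
  have hlead : (∑ a ∈ Finset.univ.erase l, p a * P a l).degree < (p l * P l l).degree := by
    refine degree_lt_of_mem_zdegLE (Submodule.sum_mem _ fun a ha => zdegLE_mono ?_ (hterm a l))
      (mul_ne_zero hl hPl)
    have := tieBreak_add_swap (Finset.ne_of_mem_erase ha).symm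
    rw [natDegree_mul hl hPl]
    omega
  have hsplit : Matrix.vecMul p P l = ∑ a ∈ Finset.univ.erase l, p a * P a l + p l * P l l :=
    (Finset.sum_erase_add _ _ (Finset.mem_univ l)).symm
  have hdeg : (Matrix.vecMul p P l).natDegree = (p l).natDegree + (P l l).natDegree := by
    rw [hsplit, natDegree_add_eq_right_of_degree_lt hlead, natDegree_mul hl hPl]
  refine ⟨isPivotIndex_iff.mpr ⟨fun h0 => ?_, fun k => ?_⟩, hdeg⟩
  · rw [hsplit, ← degree_eq_bot, degree_add_eq_right_of_degree_lt hlead, degree_eq_bot] at h0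
    exact mul_ne_zero hl hPl h0
  · refine Submodule.sum_mem _ fun a _ => zdegLE_mono ?_ (hterm a k)
    have := tieBreak_triangle l a k
    rw [hdeg]
    omega

end IsPivotIndex

section IsPopovSolutionBasis

variable {ι ρ : Type*} [Fintype ι] [LinearOrder ι] {s : ι → ℤ} {a : K[X]} {F : ι → K[X]}
  {δ : ι → ℕ} {x : ι → K[X]} {l : ι}

theorem HasPivotDegree.natDegree_eq {P : Matrix ρ ι K[X]} {δ : ρ → ℕ} {k : ρ}
    (h : HasPivotDegree s P δ) (hl : IsPivotIndex s (P k) l) : (P k l).natDegree = δ k := by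
  obtain ⟨j, hj, hdeg⟩ := h k
  rw [hl.unique hj, natDegree_eq_of_degree_eq_some hdeg]

theorem rowDegree_eq {P : Matrix ρ ι K[X]} {k : ρ} (hl : IsPivotIndex s (P k) l) :
    rowDegree s P k = (P k l).natDegree + s l := by
  rw [rowDegree, hl.shiftedDegree_eq, WithBot.unbotD_coe]

theorem mem_solutionModule {ι : Type*} [Fintype ι] {F x : ι → K[X]} :
    x ∈ solutionModule a F ↔ a ∣ x ⬝ᵥ F :=
  Iff.rfl

namespace IsPopovSolutionBasis

variable {P : Matrix ι ι K[X]}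

theorem mem_iff_exists_vecMul (h : IsPopovSolutionBasis s a F P) :
    x ∈ solutionModule a F ↔ ∃ w, Matrix.vecMul w P = x := by
  rw [← h.1.2, Submodule.mem_span_range_iff_exists_fun]
  simp only [Matrix.vecMul_eq_sum]
  rfl

theorem row_mem (h : IsPopovSolutionBasis s a F P) (k : ι) : P k ∈ solutionModule a F :=
  h.mem_iff_exists_vecMul.mpr ⟨Pi.single k 1, Matrix.single_one_vecMul k P⟩

theorem isPivotIndex_and_degree_lt (h : IsPopovSolutionBasis s a F P) (k : ι) :
    IsPivotIndex s (P k) k ∧ ∀ l, l ≠ k → (P l k).degree < (P k k).degree := by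
  obtain ⟨-, -, piv, hmono, hpiv, -, hcol⟩ := h
  have hself (k : ι) : piv k = k := le_antisymm hmono.apply_le hmono.le_apply
  simp only [hself] at hpiv hcol
  exact ⟨hpiv k, hcol k⟩

theorem isPivotIndex (h : IsPopovSolutionBasis s a F P) (k : ι) : IsPivotIndex s (P k) k :=
  (h.isPivotIndex_and_degree_lt k).1

theorem mem_zdegLE_of_ne (h : IsPopovSolutionBasis s a F P) {k l : ι} (hkl : l ≠ k) :
    P l k ∈ zdegLE K ((P k k).natDegree - 1) :=
  mem_zdegLE_of_degree_lt ((h.isPivotIndex_and_degree_lt k).2 l hkl)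

theorem mem_zdegLE (h : IsPopovSolutionBasis s a F P) (k l : ι) :
    P l k ∈ zdegLE K (P k k).natDegree := by
  rcases eq_or_ne l k with rfl | hkl
  · exact mem_zdegLE_natDegree _
  · exact zdegLE_mono (by omega) (h.mem_zdegLE_of_ne hkl)

theorem isMinimalDegree (h : IsPopovSolutionBasis s a F P) :
    IsMinimalDegree s a F fun k => (P k k).natDegree :=
  ⟨P, h, fun k => ⟨k, h.isPivotIndex k, degree_eq_natDegree (h.isPivotIndex k).apply_ne_zero⟩⟩

theorem exists_vecMul_isPivotIndex (h : IsPopovSolutionBasis s a F P)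
    (hx : x ∈ solutionModule a F) (hl : IsPivotIndex s x l) :
    ∃ w, Matrix.vecMul w P = x ∧
      IsPivotIndex (fun k => ((P k k).natDegree : ℤ) + s k) w l ∧
      (x l).natDegree = (w l).natDegree + (P l l).natDegree := by
  obtain ⟨w, rfl⟩ := h.mem_iff_exists_vecMul.mp hx
  have hw : w ≠ 0 := fun hw => hl.1 (by rw [hw, Matrix.zero_vecMul])
  obtain ⟨j, hj⟩ := exists_isPivotIndex (fun k => ((P k k).natDegree : ℤ) + s k) hw
  obtain ⟨hpiv, hdeg⟩ := hj.vecMul h.isPivotIndex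
  obtain rfl := hl.unique hpiv
  exact ⟨w, rfl, hj, hdeg⟩

theorem vecMul_mem_zdegLE (h : IsPopovSolutionBasis s a F P) {w : ι → K[X]} {N : ℤ}
    (hw : ∀ k, w k ∈ zdegLE K N) (hl : w l = 0) :
    Matrix.vecMul w P l ∈ zdegLE K (N + ((P l l).natDegree - 1)) := by
  refine Submodule.sum_mem _ fun k _ => ?_
  rcases eq_or_ne k l with rfl | hk
  · rw [hl, zero_mul]
    exact zero_mem _
  · exact mul_mem_zdegLE (hw k) (h.mem_zdegLE_of_ne hk)

end IsPopovSolutionBasis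

namespace IsMinimalDegree

theorem exists_reduced (h : IsMinimalDegree s a F δ) (l : ι) :
    ∃ x ∈ solutionModule a F, IsPivotIndex s x l ∧ (x l).natDegree = δ l ∧
      ∀ k ≠ l, x k ∈ zdegLE K (δ k - 1) := by
  obtain ⟨P, hP, hδ⟩ := h
  refine ⟨P l, hP.row_mem l, hP.isPivotIndex l, hδ.natDegree_eq (hP.isPivotIndex l),
    fun k hk => ?_⟩
  rw [← hδ.natDegree_eq (hP.isPivotIndex k)]
  exact hP.mem_zdegLE_of_ne hk.symm

theorem le_natDegree (h : IsMinimalDegree s a F δ) (hx : x ∈ solutionModule a F)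
    (hl : IsPivotIndex s x l) : δ l ≤ (x l).natDegree := by
  obtain ⟨P, hP, hδ⟩ := h
  obtain ⟨w, -, -, hdeg⟩ := hP.exists_vecMul_isPivotIndex hx hl
  rw [hdeg, hδ.natDegree_eq (hP.isPivotIndex l)]
  exact Nat.le_add_left _ _

theorem eq_zero_of_mem_zdegLE (h : IsMinimalDegree s a F δ) (hx : x ∈ solutionModule a F)
    (hdeg : ∀ k, x k ∈ zdegLE K (δ k - 1)) : x = 0 := by
  by_contra h0
  obtain ⟨l, hl⟩ := exists_isPivotIndex s h0
  have hle := h.le_natDegree hx hl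
  have hlt := natDegree_le_of_mem_zdegLE (hdeg l) hl.apply_ne_zero
  omega

/-- The row vectors `x` with `deg x_k < δ_k` embed into `K[X] / a`. -/
theorem sum_le_natDegree (h : IsMinimalDegree s a F δ) (ha : a ≠ 0) :
    ∑ k, δ k ≤ a.natDegree := by
  let residue : ((k : ι) → degreeLT K (δ k)) →ₗ[K] AdjoinRoot a :=
    LinearMap.lsum K _ K fun k => (AdjoinRoot.mkₐ a).toLinearMap ∘ₗ
      LinearMap.mulRight K (F k) ∘ₗ (degreeLT K (δ k)).subtype
  have hresidue (x) : residue x = AdjoinRoot.mk a ((fun k => (x k : K[X])) ⬝ᵥ F) := by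
    simp [residue, dotProduct]
  have hinj : Function.Injective residue := by
    rw [injective_iff_map_eq_zero]
    intro x hx
    rw [hresidue, AdjoinRoot.mk_eq_zero] at hx
    have hx0 := h.eq_zero_of_mem_zdegLE hx fun k => by
      rw [zdegLE, sub_add_cancel, Int.toNat_natCast]
      exact (x k).2
    exact funext fun k => Subtype.ext (congrFun hx0 k)
  have := (AdjoinRoot.powerBasis ha).finite
  have hrank := LinearMap.finrank_le_finrank_of_injective hinj
  rw [Module.finrank_pi_fintype, (AdjoinRoot.powerBasis ha).finrank,
    AdjoinRoot.powerBasis_dim] at hrank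
  simpa only [(degreeLTEquiv K _).finrank_eq, Module.finrank_fin_fun] using hrank

theorem apply_le_natDegree (h : IsMinimalDegree s a F δ) (ha : a ≠ 0) (k : ι) :
    δ k ≤ a.natDegree :=
  (Finset.single_le_sum (fun _ _ => Nat.zero_le _) (Finset.mem_univ k)).trans
    (h.sum_le_natDegree ha)

end IsMinimalDegree

theorem dotProduct_comp_of_injective {R ι κ : Type*} [NonUnitalNonAssocSemiring R] [Fintype ι]
    [Fintype κ] {f : κ → ι} (hf : Function.Injective f) {x y : ι → R}
    (h : ∀ k ∉ Set.range f, x k * y k = 0) : (x ∘ f) ⬝ᵥ (y ∘ f) = x ⬝ᵥ y :=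
  Fintype.sum_of_injective f hf _ _ h fun _ => rfl

namespace IsMinimalDegree

variable {κ : Type*} [Fintype κ] [LinearOrder κ] {δ' : κ → ℕ}

theorem le_comp (h : IsMinimalDegree s a F δ) (f : κ ↪o ι)
    (h' : IsMinimalDegree (s ∘ f) a (F ∘ f) δ') (k : κ) : δ (f k) ≤ δ' k := by
  obtain ⟨x, hx, hpiv, hdeg, -⟩ := h'.exists_reduced k
  let y : ι → K[X] := Function.extend f x 0
  have hcomp : y ∘ f = x := Function.extend_comp f.injective _ _
  have hzero (l : ι) (hl : l ∉ Set.range f) : y l = 0 := Function.extend_apply' _ _ l hl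
  rw [← hdeg, ← congrFun hcomp k]
  refine h.le_natDegree ?_ ((isPivotIndex_orderEmbedding_iff f).mpr ⟨by rwa [hcomp], ?_⟩)
  · rwa [mem_solutionModule, ← dotProduct_comp_of_injective f.injective, hcomp]
    exact fun l hl => by rw [hzero l hl, zero_mul]
  · intro l hl
    rw [hzero l hl]
    exact zero_mem _

theorem eq_comp (h : IsMinimalDegree s a F δ) (f : κ ↪o ι)
    (h' : IsMinimalDegree (s ∘ f) a (F ∘ f) δ') {k : κ}
    (hlt : ∀ l ∉ Set.range f, δ (f k) + s (f k) < s l) : δ (f k) = δ' k := by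
  refine (h.le_comp f h' k).antisymm ?_
  obtain ⟨x, hx, hpiv, hdeg, -⟩ := h.exists_reduced (f k)
  have hzero (l : ι) (hl : l ∉ Set.range f) : x l = 0 := by
    refine eq_zero_of_mem_zdegLE_of_neg (hpiv.mem_zdegLE l) ?_
    have := hlt l hl
    have := tieBreak_nonneg (f k) l
    omega
  rw [← hdeg]
  refine h'.le_natDegree (x := x ∘ f) ?_ ((isPivotIndex_orderEmbedding_iff f).mp hpiv).1
  rwa [mem_solutionModule, dotProduct_comp_of_injective f.injective]
  exact fun l hl => by rw [hzero l hl, zero_mul]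

end IsMinimalDegree

end IsPopovSolutionBasis

section Head

variable {m : ℕ} {α : Type*} (π : Equiv.Perm (Fin m)) (i : ℕ)

theorem forall_iff_head_tail {P : Fin m → Prop} :
    (∀ k, P k) ↔ (∀ k : Head π i, P k) ∧ ∀ l : Tail π i, P l :=
  ⟨fun h => ⟨fun k => h k, fun l => h l⟩,
    fun h k => if hk : (π.symm k : ℕ) < i then h.1 ⟨k, hk⟩ else h.2 ⟨k, hk⟩⟩

theorem sum_head_add_sum_tail [AddCommMonoid α] (f : Fin m → α) :
    ∑ k : Head π i, f k + ∑ l : Tail π i, f l = ∑ k, f k :=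
  Fintype.sum_subtype_add_sum_subtype _ f

variable {i}

theorem nonempty_head (h0 : 0 < i) (hm : 0 < m) : Nonempty (Head π i) :=
  ⟨π ⟨0, hm⟩, (congrArg Fin.val (π.symm_apply_apply _)).trans_lt h0⟩

theorem nonempty_tail (hm : i < m) : Nonempty (Tail π i) :=
  ⟨π ⟨i, hm⟩, (congrArg Fin.val (π.symm_apply_apply ⟨i, hm⟩)).not_lt⟩

variable {π}

theorem glue_head (d : Head π i → α) (e : Tail π i → α) (k : Head π i) : glue π i d e k = d k :=
  dif_pos k.2

theorem glue_tail (d : Head π i → α) (e : Tail π i → α) (l : Tail π i) : glue π i d e l = e l :=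
  dif_neg l.2

theorem appendEntry_castSucc (v : Fin m → α) (c : α) (k : Fin m) :
    appendEntry v c k.castSucc = v k :=
  Fin.snoc_castSucc ..

theorem appendEntry_last (v : Fin m → α) (c : α) : appendEntry v c (Fin.last m) = c :=
  Fin.snoc_last ..

theorem dotProduct_appendEntry (x : Fin (m + 1) → K[X]) (F : Fin m → K[X]) (c : K[X]) :
    x ⬝ᵥ appendEntry F c = (fun k => x k.castSucc) ⬝ᵥ F + x (Fin.last m) * c := by
  simp only [dotProduct, Fin.sum_univ_castSucc, appendEntry_castSucc, appendEntry_last]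

theorem isPivotIndex_castSucc_iff {u : Fin (m + 1) → ℤ} {z : Fin (m + 1) → K[X]} {l : Fin m} :
    IsPivotIndex u z l.castSucc ↔
      IsPivotIndex (fun k => u k.castSucc) (fun k => z k.castSucc) l ∧
      z (Fin.last m) ∈
        zdegLE K ((z l.castSucc).natDegree + u l.castSucc - u (Fin.last m) - 1) := by
  have htie : tieBreak l.castSucc (Fin.last m) = 1 := if_pos l.castSucc_lt_last
  rw [← htie]
  refine (isPivotIndex_orderEmbedding_iff Fin.castSuccOrderEmb).trans
    (and_congr_right' ⟨fun h => h _ ?_, fun h k hk => ?_⟩)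
  · rintro ⟨k, hk⟩
    exact k.castSucc_ne_last hk
  · induction k using Fin.lastCases with
    | last => exact h
    | cast k => exact (hk ⟨k, rfl⟩).elim

theorem isPivotIndex_tail_iff {s : Fin m → ℤ} {x : Fin m → K[X]} {l : Tail π i} :
    IsPivotIndex s x l ↔
      IsPivotIndex (fun k : Tail π i => s k) (fun k => x k) l ∧
      ∀ k : Head π i, x k ∈ zdegLE K ((x l).natDegree + s l - s k - tieBreak (l : Fin m) k) := by
  refine (isPivotIndex_orderEmbedding_iff
    (OrderEmbedding.subtype fun k : Fin m => ¬ (π.symm k : ℕ) < i)).trans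
    (and_congr_right' ⟨fun h k => h k ?_, fun h k hk => h ⟨k, by_contra fun hk' => ?_⟩⟩)
  · rintro ⟨l, hl : (l : Fin m) = k⟩
    exact l.2 (hl ▸ k.2)
  · exact hk ⟨⟨k, hk'⟩, rfl⟩

end Head

section cofactor

variable {ι : Type*} [Fintype ι] {a : K[X]} {F x : ι → K[X]} {N M : ℤ}

theorem dotProduct_mem_zdegLE (hx : ∀ k, x k ∈ zdegLE K N) (hF : ∀ k, F k ∈ zdegLE K M) :
    x ⬝ᵥ F ∈ zdegLE K (N + M) :=
  Submodule.sum_mem _ fun k _ => mul_mem_zdegLE (hx k) (hF k)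

theorem exists_cofactor (ha : a ≠ 0) (hF : ∀ k, (F k).degree < a.degree)
    (hx : x ∈ solutionModule a F) (hN : ∀ k, x k ∈ zdegLE K N) :
    ∃ y ∈ zdegLE K (N - 1), x ⬝ᵥ F + y * a = 0 := by
  obtain ⟨y, hy⟩ := mem_solutionModule.mp hx
  have hdeg := dotProduct_mem_zdegLE hN fun k => mem_zdegLE_of_degree_lt (hF k)
  rw [hy] at hdeg
  refine ⟨-y, neg_mem (zdegLE_mono (by omega) (mem_zdegLE_of_mul_mem hdeg ha)), ?_⟩
  rw [hy]
  ring

theorem mem_solutionModule_of_add_mul_eq_zero {y : K[X]} (h : x ⬝ᵥ F + y * a = 0) :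
    x ∈ solutionModule a F :=
  ⟨-y, by linear_combination h⟩

end cofactor

section IsSplitOrderBasis

variable {m : ℕ} {π : Equiv.Perm (Fin m)} {i : ℕ} {𝔪 : K[X]} {F : Fin m → K[X]} {s : Fin m → ℤ}
  {δ : Fin m → ℕ} {σ : ℕ}

/-- The minimum of `s⁽²⁾ = s_{[i+1:]}`; it is `0` when there is no tail index. -/
noncomputable def tailMin (π : Equiv.Perm (Fin m)) (i : ℕ) (s : Fin m → ℤ) : ℤ :=
  ⨅ l : Tail π i, s l

/-- The shift `d = -δ_{[:i]} + min(s⁽²⁾) - 2σ` on the head indices. -/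
noncomputable def headShift (π : Equiv.Perm (Fin m)) (i : ℕ) (s : Fin m → ℤ) (δ : Fin m → ℕ) (σ : ℕ)
    (k : Head π i) : ℤ :=
  -(δ k : ℤ) + tailMin π i s - 2 * (σ : ℤ)

/-- The shift `u = (v, min(d))` of the order basis. -/
noncomputable def splitShift (π : Equiv.Perm (Fin m)) (i : ℕ) (s : Fin m → ℤ) (δ : Fin m → ℕ)
    (σ : ℕ) : Fin (m + 1) → ℤ :=
  appendEntry (glue π i (headShift π i s δ σ) fun l => s l) (⨅ k, headShift π i s δ σ k)

theorem tailMin_le (l : Tail π i) : tailMin π i s ≤ s l :=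
  ciInf_le (Set.finite_range fun l : Tail π i => s l).bddBelow l

theorem lt_tailMin_of_forall_lt [Nonempty (Tail π i)] {c : ℤ} (h : ∀ l : Tail π i, c < s l) :
    c < tailMin π i s := by
  obtain ⟨l, hl⟩ := exists_eq_ciInf_of_finite (f := fun l : Tail π i => s l)
  exact (h l).trans_eq hl

theorem splitShift_head (k : Head π i) :
    splitShift π i s δ σ (k : Fin m).castSucc = -(δ k : ℤ) + tailMin π i s - 2 * (σ : ℤ) := by
  rw [splitShift, appendEntry_castSucc, glue_head, headShift]

theorem splitShift_tail (l : Tail π i) : splitShift π i s δ σ (l : Fin m).castSucc = s l := by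
  rw [splitShift, appendEntry_castSucc, glue_tail]

theorem exists_splitShift_last_eq [Nonempty (Head π i)] : ∃ k₀ : Head π i,
    splitShift π i s δ σ (Fin.last m) = -(δ k₀ : ℤ) + tailMin π i s - 2 * (σ : ℤ) ∧
      ∀ k : Head π i, δ k ≤ δ k₀ := by
  obtain ⟨k₀, hk₀⟩ := exists_eq_ciInf_of_finite (f := headShift π i s δ σ)
  refine ⟨k₀, by rw [splitShift, appendEntry_last, ← hk₀, headShift], fun k => ?_⟩
  have hle := hk₀.trans_le (ciInf_le (Set.finite_range (headShift π i s δ σ)).bddBelow k)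
  simp only [headShift] at hle
  omega

/-- The setting of the splitting lemma: `δ` is the `s`-minimal degree of `(𝔪, F)`, the `s`-degrees
of its head rows are below the tail of `s`, and `B` is the order basis which computes the residual
of `(𝔪, F)`. -/
structure IsSplitOrderBasis (π : Equiv.Perm (Fin m)) (i : ℕ) (𝔪 : K[X]) (F : Fin m → K[X])
    (s : Fin m → ℤ) (δ : Fin m → ℕ) (B : Matrix (Fin (m + 1)) (Fin (m + 1)) K[X]) : Prop where
  degree_lt : ∀ k, (F k).degree < 𝔪.degree
  isMinimalDegree : IsMinimalDegree s 𝔪 F δ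
  nonempty_head : Nonempty (Head π i)
  nonempty_tail : Nonempty (Tail π i)
  gap : ∀ (k : Head π i) (l : Tail π i), δ k + s k < s l
  isPopovOrderBasis :
    IsPopovOrderBasis (splitShift π i s δ 𝔪.natDegree) (appendEntry F 𝔪) (2 * 𝔪.natDegree) B

/-- The entries of `X ^ (-2σ) B [F; 𝔪]`, where `σ = deg 𝔪`: the entry at `Fin.last m` is `𝔫`, those
at the tail indices form `G`. -/
noncomputable def splitResidual (B : Matrix (Fin (m + 1)) (Fin (m + 1)) K[X]) (𝔪 : K[X])
    (F : Fin m → K[X]) (c : Fin (m + 1)) : K[X] :=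
  ((fun l : Fin m => B c l.castSucc) ⬝ᵥ F + B c (Fin.last m) * 𝔪) / X ^ (2 * 𝔪.natDegree)

/-- The block `P⁽²⁾ = A_{[i+1:],[i+1:]}` of `B`. -/
noncomputable def tailBlock (π : Equiv.Perm (Fin m)) (i : ℕ)
    (B : Matrix (Fin (m + 1)) (Fin (m + 1)) K[X]) : Matrix (Tail π i) (Tail π i) K[X] :=
  (B.submatrix Fin.castSucc Fin.castSucc).submatrix (fun k => (k : Fin m)) fun k => (k : Fin m)

/-- The column `G` of the residual problem `(𝔫, G)`. -/
noncomputable def residualColumn (π : Equiv.Perm (Fin m)) (i : ℕ)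
    (B : Matrix (Fin (m + 1)) (Fin (m + 1)) K[X]) (𝔪 : K[X]) (F : Fin m → K[X]) : Tail π i → K[X] :=
  fun k => splitResidual B 𝔪 F (k : Fin m).castSucc

/-- The shift `t = rdeg_{s⁽²⁾}(P⁽²⁾)`, in terms of the pivot degrees of `B`. -/
noncomputable def residualShift (π : Equiv.Perm (Fin m)) (i : ℕ)
    (B : Matrix (Fin (m + 1)) (Fin (m + 1)) K[X]) (s : Fin m → ℤ) : Tail π i → ℤ :=
  fun k => (B (k : Fin m).castSucc (k : Fin m).castSucc).natDegree + s k

namespace IsSplitOrderBasis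

variable {B : Matrix (Fin (m + 1)) (Fin (m + 1)) K[X]}

theorem ne_zero (h : IsSplitOrderBasis π i 𝔪 F s δ B) : 𝔪 ≠ 0 :=
  have ⟨k⟩ := h.nonempty_head
  ne_zero_of_degree_gt (h.degree_lt k)

theorem lt_tailMin (h : IsSplitOrderBasis π i 𝔪 F s δ B) (k : Head π i) :
    δ k + s k < tailMin π i s :=
  have := h.nonempty_tail
  lt_tailMin_of_forall_lt (h.gap k)

theorem exists_splitShift_last (h : IsSplitOrderBasis π i 𝔪 F s δ B) : ∃ k₀ : Head π i,
    splitShift π i s δ 𝔪.natDegree (Fin.last m) =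
        -(δ k₀ : ℤ) + tailMin π i s - 2 * (𝔪.natDegree : ℤ) ∧
      (∀ k : Head π i, δ k ≤ δ k₀) ∧ δ k₀ ≤ 𝔪.natDegree := by
  have := h.nonempty_head
  obtain ⟨k₀, hk₀, hle⟩ := exists_splitShift_last_eq (π := π) (i := i) (s := s) (δ := δ)
    (σ := 𝔪.natDegree)
  exact ⟨k₀, hk₀, hle, h.isMinimalDegree.apply_le_natDegree h.ne_zero k₀⟩

theorem splitShift_last_le (h : IsSplitOrderBasis π i 𝔪 F s δ B) (k : Fin m) :
    splitShift π i s δ 𝔪.natDegree (Fin.last m) ≤ splitShift π i s δ 𝔪.natDegree k.castSucc := by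
  obtain ⟨k₀, hlast, hle, -⟩ := h.exists_splitShift_last
  revert k
  refine (forall_iff_head_tail π i).mpr ⟨fun a => ?_, fun l => ?_⟩
  · have := hle a
    rw [splitShift_head, hlast]
    omega
  · have := tailMin_le (s := s) l
    rw [splitShift_tail, hlast]
    omega

theorem dvd (h : IsSplitOrderBasis π i 𝔪 F s δ B) (c : Fin (m + 1)) :
    X ^ (2 * 𝔪.natDegree) ∣ (fun l : Fin m => B c l.castSucc) ⬝ᵥ F + B c (Fin.last m) * 𝔪 := by
  rw [← dotProduct_appendEntry]
  exact h.isPopovOrderBasis.row_mem c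

theorem X_pow_mul_residual (h : IsSplitOrderBasis π i 𝔪 F s δ B) (c : Fin (m + 1)) :
    X ^ (2 * 𝔪.natDegree) * splitResidual B 𝔪 F c =
      (fun l : Fin m => B c l.castSucc) ⬝ᵥ F + B c (Fin.last m) * 𝔪 :=
  EuclideanDomain.mul_div_cancel' (pow_ne_zero _ X_ne_zero) (h.dvd c)

theorem residual_mem_zdegLE (h : IsSplitOrderBasis π i 𝔪 F s δ B) {c : Fin (m + 1)} {N : ℤ}
    (hN : ∀ k : Fin m, B c k.castSucc ∈ zdegLE K N) (hlast : B c (Fin.last m) ∈ zdegLE K (N - 1)) :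
    splitResidual B 𝔪 F c ∈ zdegLE K (N - 𝔪.natDegree - 1) := by
  have hdot := dotProduct_mem_zdegLE hN fun k => mem_zdegLE_of_degree_lt (h.degree_lt k)
  have hmul := mul_mem_zdegLE hlast (mem_zdegLE_natDegree 𝔪)
  have hsum := add_mem (zdegLE_mono (by omega) hdot) hmul
  rw [← h.X_pow_mul_residual] at hsum
  refine zdegLE_mono ?_ (mem_zdegLE_of_mul_mem hsum (pow_ne_zero _ X_ne_zero))
  rw [natDegree_X_pow]
  omega

theorem exists_lift (h : IsSplitOrderBasis π i 𝔪 F s δ B) {x : Fin m → K[X]} {N : ℤ}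
    (hx : x ∈ solutionModule 𝔪 F) (hN : ∀ k, x k ∈ zdegLE K N) :
    ∃ y ∈ zdegLE K (N - 1), appendEntry x y ⬝ᵥ appendEntry F 𝔪 = 0 := by
  obtain ⟨y, hy, hxy⟩ := exists_cofactor h.ne_zero h.degree_lt hx hN
  refine ⟨y, hy, ?_⟩
  simpa only [dotProduct_appendEntry, appendEntry_castSucc, appendEntry_last] using hxy

theorem natDegree_head_le (h : IsSplitOrderBasis π i 𝔪 F s δ B) (k : Head π i) :
    (B (k : Fin m).castSucc (k : Fin m).castSucc).natDegree ≤ δ k := by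
  obtain ⟨x, hx, hpiv, hdeg, hred⟩ := h.isMinimalDegree.exists_reduced k
  obtain ⟨k₀, hlast, hle, -⟩ := h.exists_splitShift_last
  have hhead (a : Head π i) : x a ∈ zdegLE K (δ a - tieBreak (k : Fin m) a) := by
    rcases eq_or_ne (a : Fin m) k with hak | hak
    · rw [hak, tieBreak_self, sub_zero, ← hdeg]
      exact mem_zdegLE_natDegree _
    · have := tieBreak_le_one (k : Fin m) a
      exact zdegLE_mono (by omega) (hred a hak)
  have htail (l : Tail π i) : x l = 0 := by
    refine eq_zero_of_mem_zdegLE_of_neg (hpiv.mem_zdegLE l) ?_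
    have := h.gap k l
    have := tieBreak_nonneg (k : Fin m) l
    omega
  have hbound : ∀ a, x a ∈ zdegLE K (δ k₀) := by
    refine (forall_iff_head_tail π i).mpr ⟨fun a => zdegLE_mono ?_ (hhead a), fun l => ?_⟩
    · have := hle a
      have := tieBreak_nonneg (k : Fin m) a
      omega
    · rw [htail]
      exact zero_mem _
  obtain ⟨y, hy, hxy⟩ := h.exists_lift hx hbound
  rw [← hdeg, ← appendEntry_castSucc x y k]
  refine h.isPopovOrderBasis.isMinimalDegree.le_natDegree ?_
    (isPivotIndex_castSucc_iff.mpr ⟨?_, ?_⟩)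
  · rw [mem_solutionModule, hxy]
    exact dvd_zero _
  all_goals simp only [appendEntry_castSucc, appendEntry_last]
  · refine isPivotIndex_iff.mpr ⟨hpiv.apply_ne_zero,
      (forall_iff_head_tail π i).mpr ⟨fun a => zdegLE_mono ?_ (hhead a), fun l => ?_⟩⟩
    · rw [splitShift_head, splitShift_head, hdeg]
      omega
    · rw [htail]
      exact zero_mem _
  · rw [splitShift_head, hlast, hdeg]
    exact zdegLE_mono (by omega) hy

theorem residual_head (h : IsSplitOrderBasis π i 𝔪 F s δ B) (k : Head π i) :
    splitResidual B 𝔪 F (k : Fin m).castSucc = 0 := by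
  obtain ⟨k₀, hlast, -, hk₀⟩ := h.exists_splitShift_last
  have hrow := (h.isPopovOrderBasis.isPivotIndex (k : Fin m).castSucc).mem_zdegLE
  have hdeg := h.natDegree_head_le k
  have hshift := splitShift_head (s := s) (δ := δ) (σ := 𝔪.natDegree) k
  refine eq_zero_of_mem_zdegLE_of_neg (h.residual_mem_zdegLE (N := δ k₀)
    (fun a => zdegLE_mono ?_ (hrow _)) (zdegLE_mono ?_ (hrow _))) (by omega)
  · have := h.splitShift_last_le a
    have := tieBreak_nonneg (k : Fin m).castSucc a.castSucc
    omega
  · rw [tieBreak, if_pos (Fin.castSucc_lt_last _)]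
    omega

theorem natDegree_head (h : IsSplitOrderBasis π i 𝔪 F s δ B) (k : Head π i) :
    (B (k : Fin m).castSucc (k : Fin m).castSucc).natDegree = δ k := by
  have hpiv := h.isPopovOrderBasis.isPivotIndex (k : Fin m).castSucc
  have hspec := h.X_pow_mul_residual (k : Fin m).castSucc
  rw [h.residual_head, mul_zero] at hspec
  refine (h.natDegree_head_le k).antisymm (not_lt.mp fun hlt => hpiv.apply_ne_zero ?_)
  refine congrFun (h.isMinimalDegree.eq_zero_of_mem_zdegLE
    (mem_solutionModule_of_add_mul_eq_zero hspec.symm) ((forall_iff_head_tail π i).mpr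
      ⟨fun a => zdegLE_mono ?_ (hpiv.mem_zdegLE _), fun l => zdegLE_mono ?_ (hpiv.mem_zdegLE _)⟩)) _
  · have := tieBreak_nonneg (k : Fin m).castSucc (a : Fin m).castSucc
    rw [splitShift_head, splitShift_head]
    omega
  · have := tailMin_le (s := s) l
    have := tieBreak_nonneg (k : Fin m).castSucc (l : Fin m).castSucc
    rw [splitShift_head, splitShift_tail]
    omega

theorem sum_natDegree_le (h : IsSplitOrderBasis π i 𝔪 F s δ B) :
    ∑ k : Head π i, δ k + ∑ l : Tail π i, (B (l : Fin m).castSucc (l : Fin m).castSucc).natDegree +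
      (B (Fin.last m) (Fin.last m)).natDegree ≤ 2 * 𝔪.natDegree := by
  have hsum := h.isPopovOrderBasis.isMinimalDegree.sum_le_natDegree (pow_ne_zero _ X_ne_zero)
  rw [Fin.sum_univ_castSucc, ← sum_head_add_sum_tail π i, natDegree_X_pow] at hsum
  simpa only [h.natDegree_head] using hsum

theorem natDegree_last (h : IsSplitOrderBasis π i 𝔪 F s δ B) :
    splitResidual B 𝔪 F (Fin.last m) ≠ 0 ∧ (B (Fin.last m) (Fin.last m)).natDegree =
      (splitResidual B 𝔪 F (Fin.last m)).natDegree + 𝔪.natDegree := by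
  have hpiv := h.isPopovOrderBasis.isPivotIndex (Fin.last m)
  have hB := hpiv.apply_ne_zero
  have hrow (k : Fin m) :
      B (Fin.last m) k.castSucc ∈ zdegLE K (B (Fin.last m) (Fin.last m)).natDegree := by
    have := tieBreak_nonneg (Fin.last m) k.castSucc
    have := h.splitShift_last_le k
    exact zdegLE_mono (by omega) (hpiv.mem_zdegLE _)
  have hlead : ((fun k : Fin m => B (Fin.last m) k.castSucc) ⬝ᵥ F).degree <
      (B (Fin.last m) (Fin.last m) * 𝔪).degree := by
    refine degree_lt_of_mem_zdegLE (zdegLE_mono ?_ (dotProduct_mem_zdegLE hrow fun k =>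
      mem_zdegLE_of_degree_lt (h.degree_lt k))) (mul_ne_zero hB h.ne_zero)
    rw [natDegree_mul hB h.ne_zero]
    omega
  have hspec := h.X_pow_mul_residual (Fin.last m)
  have hne : splitResidual B 𝔪 F (Fin.last m) ≠ 0 := by
    intro h0
    rw [h0, mul_zero] at hspec
    have := degree_add_eq_right_of_degree_lt hlead
    rw [← hspec, degree_zero, eq_comm, degree_eq_bot] at this
    exact mul_ne_zero hB h.ne_zero this
  refine ⟨hne, ?_⟩
  have hdeg := congrArg natDegree hspec
  rw [natDegree_add_eq_right_of_degree_lt hlead, natDegree_mul (pow_ne_zero _ X_ne_zero) hne,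
    natDegree_X_pow, natDegree_mul hB h.ne_zero] at hdeg
  omega

theorem degree_residualColumn_lt (h : IsSplitOrderBasis π i 𝔪 F s δ B) (l : Tail π i) :
    (residualColumn π i B 𝔪 F l).degree < (splitResidual B 𝔪 F (Fin.last m)).degree := by
  obtain ⟨hne, hlast⟩ := h.natDegree_last
  have hsum := h.sum_natDegree_le
  have hcol := h.isPopovOrderBasis.mem_zdegLE
  refine degree_lt_of_mem_zdegLE (zdegLE_mono ?_ (h.residual_mem_zdegLE
    (N := (B (Fin.last m) (Fin.last m)).natDegree) ((forall_iff_head_tail π i).mpr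
      ⟨fun a => zdegLE_mono ?_ (hcol _ _), fun l => zdegLE_mono ?_ (hcol _ _)⟩)
    (h.isPopovOrderBasis.mem_zdegLE_of_ne (Fin.castSucc_ne_last _)))) hne
  · omega
  · have := h.isMinimalDegree.apply_le_natDegree h.ne_zero a
    rw [h.natDegree_head]
    omega
  · have := Finset.single_le_sum (fun (l : Tail π i) _ => Nat.zero_le
      (B (l : Fin m).castSucc (l : Fin m).castSucc).natDegree) (Finset.mem_univ l)
    omega

theorem isPivotIndex_tail (h : IsSplitOrderBasis π i 𝔪 F s δ B) (l : Tail π i) :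
    IsPivotIndex (fun k : Tail π i => s k) (tailBlock π i B l) l := by
  have hpiv := isPivotIndex_castSucc_iff.mp (h.isPopovOrderBasis.isPivotIndex (l : Fin m).castSucc)
  have htail := (isPivotIndex_tail_iff.mp hpiv.1).1
  simp only [splitShift_tail] at htail
  exact htail

theorem rowDegree_tailBlock (h : IsSplitOrderBasis π i 𝔪 F s δ B) :
    rowDegree (fun k : Tail π i => s k) (tailBlock π i B) = residualShift π i B s :=
  funext fun l => rowDegree_eq (h.isPivotIndex_tail l)

theorem X_pow_mul_dotProduct_residual (h : IsSplitOrderBasis π i 𝔪 F s δ B)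
    (z : Fin (m + 1) → K[X]) :
    X ^ (2 * 𝔪.natDegree) * ((fun k : Tail π i => z (k : Fin m).castSucc) ⬝ᵥ
        residualColumn π i B 𝔪 F + z (Fin.last m) * splitResidual B 𝔪 F (Fin.last m)) =
      Matrix.vecMul z B ⬝ᵥ appendEntry F 𝔪 := by
  have hresidual : B.mulVec (appendEntry F 𝔪) =
      (X ^ (2 * 𝔪.natDegree) : K[X]) • splitResidual B 𝔪 F := by
    funext c
    rw [Pi.smul_apply, smul_eq_mul, h.X_pow_mul_residual, ← dotProduct_appendEntry]
    rfl
  have hsplit : z ⬝ᵥ splitResidual B 𝔪 F =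
      (fun k : Tail π i => z (k : Fin m).castSucc) ⬝ᵥ residualColumn π i B 𝔪 F +
        z (Fin.last m) * splitResidual B 𝔪 F (Fin.last m) := by
    rw [dotProduct, Fin.sum_univ_castSucc, ← sum_head_add_sum_tail π i]
    simp only [h.residual_head, mul_zero, Finset.sum_const_zero, zero_add, dotProduct,
      residualColumn]
  rw [← Matrix.dotProduct_mulVec, hresidual, dotProduct_smul, smul_eq_mul, hsplit]

theorem exists_residual_lift (h : IsSplitOrderBasis π i 𝔪 F s δ B) {w : Tail π i → K[X]}
    {l : Tail π i} {N : ℤ} (hN : N = (w l).natDegree + residualShift π i B s l - tailMin π i s)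
    (hw : w ∈ solutionModule (splitResidual B 𝔪 F (Fin.last m)) (residualColumn π i B 𝔪 F))
    (hl : IsPivotIndex (residualShift π i B s) w l) :
    ∃ y ∈ zdegLE K (N - 1), (∀ k, w k ∈ zdegLE K N) ∧
      Matrix.vecMul (appendEntry (glue π i 0 w) y) B ⬝ᵥ appendEntry F 𝔪 = 0 := by
  have hwN (k : Tail π i) : w k ∈ zdegLE K N := by
    have := tailMin_le (s := s) k
    have := tieBreak_nonneg l k
    refine zdegLE_mono ?_ (hl.mem_zdegLE k)
    simp only [residualShift] at hN ⊢
    omega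
  obtain ⟨y, hy, hwy⟩ := exists_cofactor h.natDegree_last.1 h.degree_residualColumn_lt hw hwN
  refine ⟨y, hy, hwN, ?_⟩
  rw [← h.X_pow_mul_dotProduct_residual]
  simp only [appendEntry_castSucc, glue_tail, appendEntry_last, hwy, mul_zero]

theorem exists_isPivotIndex_of_residual (h : IsSplitOrderBasis π i 𝔪 F s δ B) {w : Tail π i → K[X]}
    {l : Tail π i}
    (hw : w ∈ solutionModule (splitResidual B 𝔪 F (Fin.last m)) (residualColumn π i B 𝔪 F))
    (hl : IsPivotIndex (residualShift π i B s) w l) :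
    ∃ x ∈ solutionModule 𝔪 F, IsPivotIndex s x l ∧ (x l).natDegree =
      (w l).natDegree + (B (l : Fin m).castSucc (l : Fin m).castSucc).natDegree := by
  obtain ⟨y, hy, hwN, hker⟩ := h.exists_residual_lift rfl hw hl
  simp only [residualShift] at hy hwN
  set z : Fin (m + 1) → K[X] := appendEntry (glue π i 0 w) y with hz
  have hzhead (k : Head π i) : z (k : Fin m).castSucc = 0 := by
    rw [hz, appendEntry_castSucc, glue_head, Pi.zero_apply]
  have hztail (k : Tail π i) : z (k : Fin m).castSucc = w k := by
    rw [hz, appendEntry_castSucc, glue_tail]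
  have hzlast : z (Fin.last m) = y := by rw [hz, appendEntry_last]
  have hzpiv : IsPivotIndex (fun c => ((B c c).natDegree : ℤ) + splitShift π i s δ 𝔪.natDegree c) z
      (l : Fin m).castSucc := by
    refine isPivotIndex_castSucc_iff.mpr ⟨isPivotIndex_tail_iff.mpr ⟨?_, fun k => ?_⟩, ?_⟩
    · simp only [splitShift_tail, hztail]
      exact hl
    · rw [hzhead]
      exact zero_mem _
    · obtain ⟨k₀, hlast, -, -⟩ := h.exists_splitShift_last
      have := h.sum_natDegree_le
      rw [hzlast, hztail, splitShift_tail, hlast]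
      exact zdegLE_mono (by omega) hy
  obtain ⟨hpiv, hdeg⟩ := hzpiv.vecMul h.isPopovOrderBasis.isPivotIndex
  rw [hztail] at hdeg
  rw [dotProduct_appendEntry] at hker
  refine ⟨fun k => Matrix.vecMul z B k.castSucc, mem_solutionModule_of_add_mul_eq_zero hker,
    isPivotIndex_tail_iff.mpr ⟨?_, fun k => ?_⟩, hdeg⟩
  · simpa only [splitShift_tail] using
      (isPivotIndex_tail_iff.mp (isPivotIndex_castSucc_iff.mp hpiv).1).1
  · refine zdegLE_mono ?_ (h.isPopovOrderBasis.vecMul_mem_zdegLE (Fin.forall_fin_succ'.mpr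
      ⟨(forall_iff_head_tail π i).mpr ⟨fun k => ?_, fun k => (hztail k).symm ▸ hwN k⟩,
        hzlast.symm ▸ zdegLE_mono (by omega) hy⟩) (hzhead k))
    · have := h.lt_tailMin k
      have := tieBreak_le_one (l : Fin m) k
      rw [hdeg, h.natDegree_head]
      omega
    · rw [hzhead]
      exact zero_mem _

theorem exists_isPivotIndex_residual (h : IsSplitOrderBasis π i 𝔪 F s δ B) (l : Tail π i) :
    ∃ w ∈ solutionModule (splitResidual B 𝔪 F (Fin.last m)) (residualColumn π i B 𝔪 F),
      IsPivotIndex (residualShift π i B s) w l ∧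
      δ l = (w l).natDegree + (B (l : Fin m).castSucc (l : Fin m).castSucc).natDegree := by
  obtain ⟨x, hx, hpiv, hdeg, hred⟩ := h.isMinimalDegree.exists_reduced l
  obtain ⟨k₀, hlast, hle, -⟩ := h.exists_splitShift_last
  have hl := tailMin_le (s := s) l
  have hhead (k : Head π i) : x k ∈ zdegLE K (δ k - 1) := hred k fun hkl => l.2 (hkl ▸ k.2)
  have hbound : ∀ k, x k ∈ zdegLE K (δ l + s l - tailMin π i s + δ k₀) := by
    refine (forall_iff_head_tail π i).mpr ⟨fun k => zdegLE_mono ?_ (hhead k),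
      fun k => zdegLE_mono ?_ (hpiv.mem_zdegLE k)⟩
    · have := hle k
      omega
    · have := tailMin_le (s := s) k
      have := tieBreak_nonneg (l : Fin m) k
      omega
  obtain ⟨y, hy, hxy⟩ := h.exists_lift hx hbound
  have hz : IsPivotIndex (splitShift π i s δ 𝔪.natDegree) (appendEntry x y)
      (l : Fin m).castSucc := by
    refine isPivotIndex_castSucc_iff.mpr ⟨isPivotIndex_tail_iff.mpr ⟨?_, fun k => ?_⟩, ?_⟩
    all_goals simp only [appendEntry_castSucc, appendEntry_last, splitShift_tail]
    · exact (isPivotIndex_tail_iff.mp hpiv).1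
    · have := tieBreak_le_one (l : Fin m) k
      rw [hdeg, splitShift_head]
      exact zdegLE_mono (by omega) (hhead k)
    · rw [hdeg, hlast]
      exact zdegLE_mono (by omega) hy
  obtain ⟨w, hwB, hw, hwdeg⟩ := h.isPopovOrderBasis.exists_vecMul_isPivotIndex
    (mem_solutionModule.mpr (hxy ▸ dvd_zero _)) hz
  rw [appendEntry_castSucc, hdeg] at hwdeg
  have hwR := h.X_pow_mul_dotProduct_residual w
  rw [hwB, hxy, mul_eq_zero_iff_left (pow_ne_zero _ X_ne_zero)] at hwR
  have hwtail := (isPivotIndex_tail_iff.mp (isPivotIndex_castSucc_iff.mp hw).1).1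
  simp only [splitShift_tail] at hwtail
  exact ⟨_, mem_solutionModule_of_add_mul_eq_zero hwR, hwtail, hwdeg⟩

theorem minimalDegree_tail (h : IsSplitOrderBasis π i 𝔪 F s δ B) {δ₃ : Tail π i → ℕ}
    (h₃ : IsMinimalDegree (residualShift π i B s) (splitResidual B 𝔪 F (Fin.last m))
      (residualColumn π i B 𝔪 F) δ₃) (l : Tail π i) :
    δ l = (B (l : Fin m).castSucc (l : Fin m).castSucc).natDegree + δ₃ l := by
  obtain ⟨v, hv, hvpiv, hvdeg, -⟩ := h₃.exists_reduced l
  obtain ⟨x, hx, hxpiv, hxdeg⟩ := h.exists_isPivotIndex_of_residual hv hvpiv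
  obtain ⟨w, hw, hwpiv, hwdeg⟩ := h.exists_isPivotIndex_residual l
  have hle := h.isMinimalDegree.le_natDegree hx hxpiv
  have hge := h₃.le_natDegree hw hwpiv
  omega

end IsSplitOrderBasis

end IsSplitOrderBasis

section IsSplittingIndex

theorem IsSplittingIndex.lt_of_monotone {ι : Type*} {n i : ℕ} {d : ι → ℕ} {t : ι → ℤ}
    (h : IsSplittingIndex n d t i) (ν : Fin n ≃ ι) (hν : Monotone (t ∘ ν)) {a b : Fin n}
    (ha : a < i) (hb : i ≤ b) : d (ν a) + t (ν a) < t (ν b) := by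
  obtain ⟨-, hin, μ, hμ, hlt⟩ := h
  have hμν : t ∘ ν ∘ (μ.trans ν.symm) = t ∘ μ := by
    rw [← Equiv.coe_trans, Equiv.trans_assoc, Equiv.symm_trans_self, Equiv.trans_refl]
  have hsort (c : Fin n) : t (ν c) = t (μ c) :=
    congrFun ((Tuple.unique_monotone (f := t ∘ ν) (σ := Equiv.refl _) (τ := μ.trans ν.symm) hν
      (hμν ▸ hμ)).trans hμν) c
  obtain ⟨c, hc⟩ := μ.surjective (ν a)
  have hac := hlt a ha
  have hci : c < i := by
    by_contra! hic
    have := hμ (a := ⟨i, hin⟩) (b := c) hic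
    simp only [Function.comp_apply, hc, hsort] at this
    omega
  have hib := hμ (a := ⟨i, hin⟩) (b := b) hb
  have := hlt c hci
  simp only [Function.comp_apply] at hib
  rw [hc] at this
  rw [hsort b]
  omega

variable {m : ℕ} {π : Equiv.Perm (Fin m)} {i j : ℕ} {s : Fin m → ℤ} {δ : Fin m → ℕ} {𝔪 : K[X]}
  {F : Fin m → K[X]}

theorem IsMinimalDegree.gap_of_isSplittingIndex {δ₀ : Head π j → ℕ}
    (hδ : IsMinimalDegree s 𝔪 F δ)
    (hδ₀ : IsMinimalDegree (fun k : Head π j => s k) 𝔪 (fun k : Head π j => F k) δ₀)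
    (hπ : Monotone (s ∘ π)) (hj : j ≤ m) (hi : IsSplittingIndex j δ₀ (fun k : Head π j => s k) i)
    (k : Head π i) (l : Tail π i) : δ k + s k < s l := by
  let ν : Fin j ≃ Head π j :=
    { toFun := fun c => ⟨π (Fin.castLE hj c), by simp⟩
      invFun := fun k => ⟨π.symm k, k.2⟩
      left_inv := fun c => by simp
      right_inv := fun k => by simp }
  have hij : i < j := hi.2.1
  let k' : Head π j := ⟨k, k.2.trans hij⟩
  have hν : Monotone ((fun k : Head π j => s k) ∘ ν) :=
    hπ.comp (Fin.strictMono_castLE hj).monotone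
  have hlt := hi.lt_of_monotone ν hν (a := ν.symm k') (b := ⟨i, hij⟩) k.2 le_rfl
  have hle := hπ (a := Fin.castLE hj ⟨i, hij⟩) (b := π.symm l) (not_lt.mp l.2)
  have hδle : δ k ≤ δ₀ k' :=
    hδ.le_comp (OrderEmbedding.subtype fun k : Fin m => (π.symm k : ℕ) < j) hδ₀ k'
  rw [Equiv.apply_symm_apply] at hlt
  simp only [Function.comp_apply, Equiv.apply_symm_apply] at hle
  exact (lt_of_le_of_lt (add_le_add_left (Nat.cast_le.mpr hδle) _) hlt).trans_le hle

theorem IsMinimalDegree.eq_head {δ₁ : Head π i → ℕ} (hδ : IsMinimalDegree s 𝔪 F δ)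
    (hδ₁ : IsMinimalDegree (fun k : Head π i => s k) 𝔪 (fun k : Head π i => F k) δ₁)
    (hgap : ∀ (k : Head π i) (l : Tail π i), δ k + s k < s l) :
    δ₁ = fun k : Head π i => δ k := by
  funext k
  refine (hδ.eq_comp (OrderEmbedding.subtype fun k : Fin m => (π.symm k : ℕ) < i) hδ₁
    fun l hl => ?_).symm
  exact hgap k ⟨l, fun hl' => hl ⟨⟨l, hl'⟩, rfl⟩⟩

end IsSplittingIndex

end

theorem lemma2p9 {K : Type*} [Field K] {m : ℕ}
    -- the problem `(𝔪, F)` and the shift `s`, with its minimal degree `δ`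
    (𝔪 : K[X]) (h𝔪 : 𝔪 ≠ 0) (F : Fin m → K[X]) (hF : ∀ k, (F k).degree < 𝔪.degree)
    (σ : ℕ) (hσ : σ = 𝔪.natDegree)
    (s : Fin m → ℤ) (π : Equiv.Perm (Fin m)) (hπ : Monotone (s ∘ π))
    (δ : Fin m → ℕ) (hδ : IsMinimalDegree s 𝔪 F δ)
    -- the splitting index `i` for the subproblem on the first `j` indices
    (i j : ℕ) (hj : j ≤ m)
    (δ₀ : Head π j → ℕ)
    (hδ₀ : IsMinimalDegree (fun k : Head π j => s k) 𝔪 (fun k : Head π j => F k) δ₀)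
    (hi : IsSplittingIndex j δ₀ (fun k : Head π j => s k) i)
    -- the minimal degree `δ₁` of the subproblem on the first `i` indices
    (δ₁ : Head π i → ℕ)
    (hδ₁ : IsMinimalDegree (fun k : Head π i => s k) 𝔪 (fun k : Head π i => F k) δ₁)
    -- the shifts `s₂`, `d` and the order basis `B` with blocks `A`, `col`, `p`, `q`
    (s₂ : Tail π i → ℤ) (hs₂ : s₂ = fun k : Tail π i => s k)
    (d : Head π i → ℤ) (hd : d = fun k => -(δ₁ k : ℤ) + (⨅ l, s₂ l) - 2 * (σ : ℤ))
    (B : Matrix (Fin (m + 1)) (Fin (m + 1)) K[X])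
    (hB : IsPopovOrderBasis (appendEntry (glue π i d s₂) (⨅ l, d l)) (appendEntry F 𝔪) (2 * σ) B)
    (A : Matrix (Fin m) (Fin m) K[X]) (hA : A = B.submatrix Fin.castSucc Fin.castSucc)
    (col : Fin m → K[X]) (hcol : col = fun k => B k.castSucc (Fin.last m))
    (p : Fin m → K[X]) (hp : p = fun l => B (Fin.last m) l.castSucc)
    (q : K[X]) (hq : q = B (Fin.last m) (Fin.last m))
    (P₂ : Matrix (Tail π i) (Tail π i) K[X]) (hP₂ : P₂ = A.submatrix (fun k : Tail π i => (k : Fin m)) (fun k : Tail π i => (k : Fin m)))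
    (δ₂ : Tail π i → ℕ) (hδ₂ : HasPivotDegree s₂ P₂ δ₂)
    -- the residual `(𝔫, G)`
    (𝔫 : K[X]) (h𝔫 : 𝔫 = (p ⬝ᵥ F + q * 𝔪) / X ^ (2 * σ))
    (G : Tail π i → K[X]) (hG : G = fun k : Tail π i => (A k ⬝ᵥ F + col k * 𝔪) / X ^ (2 * σ)) :
    -- the divisions by `X ^ (2 * σ)` are exact
    X ^ (2 * σ) ∣ p ⬝ᵥ F + q * 𝔪 ∧
    (∀ k : Tail π i, X ^ (2 * σ) ∣ A k ⬝ᵥ F + col k * 𝔪) ∧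
    (∀ k, (G k).degree < 𝔫.degree) ∧
    (𝔫.natDegree : ℤ) ≤ (σ : ℤ) - ∑ k, (δ₁ k : ℤ) - ∑ k, (δ₂ k : ℤ) ∧
    ∀ (P₃ : Matrix (Tail π i) (Tail π i) K[X]) (δ₃ : Tail π i → ℕ),
      IsPopovSolutionBasis (rowDegree s₂ P₂) 𝔫 G P₃ →
      HasPivotDegree (rowDegree s₂ P₂) P₃ δ₃ →
      (∀ k : Head π i, δ k = δ₁ k) ∧ (∀ k : Tail π i, δ k = δ₂ k + δ₃ k) := by
  subst hσ hs₂ hd hA hcol hp hq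
  obtain rfl : P₂ = tailBlock π i B := hP₂
  obtain rfl : 𝔫 = splitResidual B 𝔪 F (Fin.last m) := h𝔫
  obtain rfl : G = residualColumn π i B 𝔪 F := hG
  have hgap := hδ.gap_of_isSplittingIndex hδ₀ hπ hj hi
  obtain rfl := hδ.eq_head hδ₁ hgap
  have hij : i < j := hi.2.1
  have h : IsSplitOrderBasis π i 𝔪 F s δ B :=
    { degree_lt := hF
      isMinimalDegree := hδ
      nonempty_head := nonempty_head π hi.1 (by omega)
      nonempty_tail := nonempty_tail π (by omega)
      gap := hgap
      isPopovOrderBasis := hB }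
  have hδ₂' (l : Tail π i) : (B (l : Fin m).castSucc (l : Fin m).castSucc).natDegree = δ₂ l :=
    hδ₂.natDegree_eq (h.isPivotIndex_tail l)
  refine ⟨h.dvd _, fun k => h.dvd _, h.degree_residualColumn_lt, ?_,
    fun P₃ δ₃ hP₃ hδ₃ => ⟨fun _ => rfl, fun l => ?_⟩⟩
  · have hsum := h.sum_natDegree_le
    simp only [hδ₂', h.natDegree_last.2] at hsum
    push_cast [← Nat.cast_sum]
    omega
  · rw [h.rowDegree_tailBlock] at hP₃ hδ₃
    rw [h.minimalDegree_tail ⟨P₃, hP₃, hδ₃⟩ l, hδ₂']
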